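/- Types are given by $A,B ::= o \mid A\multimap B \mid {!A}$. A type is *purely affine* if it contains no $!$, and *almost purely affine* if $!$ is only applied to $o$ in it. Fix a ranked alphabet $\Sigma$ (a finite set of letters $c$ with ranks $\mathrm{rk}(c)\in\mathbb N$). Terms, up to renaming of bound variables, are $t,u ::= c \mid x \mid \lambda x.\,t \mid t\,u \mid {!t} \mid \mathtt{let}\ !x=u\ \mathtt{in}\ t$ with $c\in\Sigma$; contexts $C,D$ are terms with one hole $\langle\cdot\rangle$, whose filling may capture variables. Typing judgments $\Theta\mid\Phi\vdash t:A$, with unrestricted variables $\Theta$ and affine variables $\Phi$, are derived by the following rules, where $\Phi,\Phi'$ is a disjoint union: - $\Theta\mid\Phi\vdash c : o\multimap\cdots\multimap o\multimap o$ (with $\mathrm{rk}(c)$ arguments); $\Theta\mid\Phi,x:A\vdash x:A$; $\Theta,x:A\mid\Phi\vdash x:A$; - if $\Theta\mid\Phi,x:A\vdash t:B$ then $\Theta\mid\Phi\vdash\lambda x.\,t:A\multimap B$; - if $\Theta\mid\Phi\vdash t:A\multimap B$ and $\Theta\mid\Phi'\vdash u:A$ then $\Theta\mid\Phi,\Phi'\vdash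 t\,u:B$; - if $\Theta\mid\varnothing\vdash t:A$ then $\Theta\mid\Phi\vdash{!t}:{!A}$; - if $\Theta\mid\Phi\vdash u:{!A}$ and $\Theta,x:A\mid\Phi'\vdash t:B$ then $\Theta\mid\Phi,\Phi'\vdash\mathtt{let}\ !x=u\ \mathtt{in}\ t:B$. A closed term $v:o$ is *almost purely affine* if $\varnothing\mid\varnothing\vdash v:o$ has a derivation in which every subterm has an almost purely affine type, all unrestricted variables have type $o$, and, for every subterm of the form $!r$, all subterms of $r$ have purely affine types. The relation $\to_\beta$ is the closure under all contexts of the capture-avoiding rules $L\langle\lambda x.\,t\rangle\,u\to L\langle t\{x:=u\}\rangle$ and $\mathtt{let}\ !x=L\langle{!u}\rangle\ \mathtt{in}\ t\to L\langle t\{x:=u\}\rangle$, where $L::=\langle\cdot\rangle\mid\mathtt{let}\ !x'=t'\ \mathtt{in}\ L$. A tree $\tau=c(\tau_1,\dots,\tau_k)$ over $\Sigma$ is encoded by the term $\widetilde\tau=c\,\widetilde{\tau_1}\cdots\widetilde{\tau_k}$. The machine $\mathrm{APAIAM}(v)$ has as configurations the tuples $(d,t,C,T)$ with $d\in\{\downarrow,\uparrow\}$,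 $C\langle t\rangle=v$ and $T\in\{\mathsf p,\circ\}^*$, written $(C\langle{\downarrow}t\rangle,T)$ or $(C\langle{\uparrow}t\rangle,T)$. The initial configuration is $({\downarrow}v,\varepsilon)$. The computation-step partial function, from configurations to trees over $\Sigma$ that may have configurations as leaves, is $$\begin{array}{ll} (C\langle{\downarrow}(t\,u)\rangle,T)\mapsto(C\langle({\downarrow}t)\,u\rangle,\mathsf p\cdot T) & (C\langle({\uparrow}t)\,u\rangle,\mathsf p\cdot T)\mapsto(C\langle{\uparrow}(t\,u)\rangle,T)\\ (C\langle t\,({\uparrow}u)\rangle,T)\mapsto(C\langle({\downarrow}t)\,u\rangle,\circ\cdot T) & (C\langle({\uparrow}t)\,u\rangle,\circ\cdot T)\mapsto(C\langle t\,({\downarrow}u)\rangle,T)\\ (C\langle\lambda x.\,{\uparrow}t\rangle,T)\mapsto(C\langle{\uparrow}(\lambda x.\,t)\rangle,\mathsf p\cdot T) & (C\langle{\downarrow}(\lambda x.\,t)\rangle,\mathsf p\cdot T)\mapsto(C\langle\lambda x.\,{\downarrow}t\rangle,T)\\ (C\langle\lambda x.\,D\langle{\downarrow}x\rangle\rangle,T)\mapsto(C\langle{\uparrow}(\lambda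 x.\,D\langle x\rangle)\rangle,\circ\cdot T) & (C\langle{\downarrow}(\lambda x.\,D\langle x\rangle)\rangle,\circ\cdot T)\mapsto(C\langle\lambda x.\,D\langle{\uparrow}x\rangle\rangle,T)\\ (C\langle{\downarrow}(\mathtt{let}\ !x=u\ \mathtt{in}\ t)\rangle,T)\mapsto(C\langle\mathtt{let}\ !x=u\ \mathtt{in}\ {\downarrow}t\rangle,T) & (C\langle{\downarrow}{!t}\rangle,T)\mapsto(C\langle{!{\downarrow}t}\rangle,T)\\ (C\langle\mathtt{let}\ !x=u\ \mathtt{in}\ {\uparrow}t\rangle,T)\mapsto(C\langle{\uparrow}(\mathtt{let}\ !x=u\ \mathtt{in}\ t)\rangle,T) & \\ (C\langle\mathtt{let}\ !x=u\ \mathtt{in}\ D\langle{\downarrow}x\rangle\rangle,T)\mapsto(C\langle\mathtt{let}\ !x={\downarrow}u\ \mathtt{in}\ D\langle x\rangle\rangle,T) & \end{array}$$ together with, for $c\in\Sigma$ of rank $k$, $$(C\langle{\downarrow}c\rangle,\mathsf p^{k}\cdot T)\mapsto c\bigl((C\langle{\uparrow}c\rangle,\circ\cdot T),(C\langle{\uparrow}c\rangle,\mathsf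 p\cdot\circ\cdot T),\dots,(C\langle{\uparrow}c\rangle,\mathsf p^{k-1}\cdot\circ\cdot T)\bigr);$$ in the rules that mention $D\langle x\rangle$, the displayed occurrence of $x$ is bound by the displayed binder. Write $\tau_1\rightsquigarrow\tau_2$ if $\tau_2$ is obtained from $\tau_1$ by replacing one configuration leaf by its image under this function. The *output* of the machine is the unique $\rightsquigarrow$-normal form of the initial configuration, provided that it exists and has no configuration leaf. **Proposition 4.7** (soundness of the almost purely affine IAM). For every almost purely affine closed term $v:o$, there is exactly one tree $\tau$ over $\Sigma$ such that $\widetilde\tau$ is the normal form of $v$ (i.e. the unique $\to_\beta$-normal form of $v$), and $\mathrm{APAIAM}(v)$ has an output, which is this $\tau$. -/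

import Mathlib

namespace AffineIAM

universe u v

/-! ### Ranked alphabets, trees, tree-generating machines -/

/-- A ranked alphabet: a finite set of letters, each with a rank (arity). -/
structure RankedAlphabet where
  Letter : Type u
  finite : Finite Letter
  rank : Letter → ℕ

/-- `Tree S X` is the set of trees over `S` that may moreover have leaves labeled in `X`. -/
inductive Tree (S : RankedAlphabet.{u}) (X : Type v) : Type (max u v)
  | leaf (x : X) : Tree S X
  | node (c : S.Letter) (ts : Fin (S.rank c) → Tree S X) : Tree S X

/-- Trees over `S`, without additional leaves. -/
abbrev GroundTree (S : RankedAlphabet.{u}) : Type u := Tree S Empty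

/-- The inclusion of the trees over `S` into the trees with `X`-labeled leaves. -/
def GroundTree.embed {S : RankedAlphabet.{u}} (X : Type v) : GroundTree S → Tree S X
  | .leaf x => x.elim
  | .node c ts => .node c fun i => GroundTree.embed X (ts i)

/-- `b` is the normal form of `a` for the rewriting relation `r`: it is a normal form of `a`, and
`a` has no other one. -/
def IsTheNormalForm {α : Type v} (r : α → α → Prop) (a b : α) : Prop :=
  (Relation.ReflTransGen r a b ∧ ∀ c, ¬ r b c) ∧
    ∀ b', Relation.ReflTransGen r a b' → (∀ c, ¬ r b' c) → b' = b

/-- Tree-generating machines over `S`. The computation step is a partial function. -/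
structure TreeMachine (S : RankedAlphabet.{u}) where
  Conf : Type v
  init : Conf
  step : Conf → Option (Tree S Conf)

namespace TreeMachine

variable {S : RankedAlphabet.{u}}

/-- One rewriting step of a machine: a single configuration leaf is replaced by its image by the
computation-step function. -/
inductive Rewrites (M : TreeMachine.{u, v} S) : Tree S M.Conf → Tree S M.Conf → Prop
  | leaf {κ : M.Conf} {t : Tree S M.Conf} (h : M.step κ = some t) : Rewrites M (.leaf κ) t
  | node (c : S.Letter) (ts : Fin (S.rank c) → Tree S M.Conf) (i : Fin (S.rank c))
      {t : Tree S M.Conf} (h : Rewrites M (ts i) t) :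
      Rewrites M (.node c ts) (.node c (Function.update ts i t))

/-- The machine converges and `τ` is its output: the normal form of the initial configuration
exists, and it is `τ`, a tree without configuration leaves. -/
def IsOutput (M : TreeMachine.{u, v} S) (τ : GroundTree S) : Prop :=
  IsTheNormalForm M.Rewrites (.leaf M.init) (τ.embed M.Conf)

end TreeMachine

/-! ### Types and terms -/

/-- Types: `A, B ::= o | A ⊸ B | !A`. -/
inductive Ty : Type
  | o : Ty
  | arrow (A B : Ty) : Ty
  | bang (A : Ty) : Ty

namespace Ty

/-- A type is purely affine if it does not contain `!`. -/
def PurelyAffine : Ty → Prop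
  | o => True
  | arrow A B => A.PurelyAffine ∧ B.PurelyAffine
  | bang _ => False

/-- A type is almost purely affine if `!` is only applied to `o` in it. -/
def AlmostPurelyAffine : Ty → Prop
  | o => True
  | arrow A B => A.AlmostPurelyAffine ∧ B.AlmostPurelyAffine
  | bang A => A = o

/-- `o ⊸ ⋯ ⊸ o ⊸ o` with `n` arguments. -/
def firstOrder : ℕ → Ty
  | 0 => o
  | n + 1 => arrow o (firstOrder n)

end Ty

/-- `λ`-terms over the constants in `S`, up to renaming of bound variables (de Bruijn indices).
`lam t` binds the index `0` in `t`; `letBox u t` stands for `let !x = u in t`, and binds the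
index `0` in `t` but not in `u`. -/
inductive Term (S : RankedAlphabet.{u}) : Type u
  | const (c : S.Letter) : Term S
  | var (n : ℕ) : Term S
  | lam (t : Term S) : Term S
  | app (t u : Term S) : Term S
  | box (t : Term S) : Term S
  | letBox (u t : Term S) : Term S

namespace Term

variable {S : RankedAlphabet.{u}}

/-- Extend a renaming below a binder. -/
def upRen (ρ : ℕ → ℕ) : ℕ → ℕ
  | 0 => 0
  | n + 1 => ρ n + 1

/-- Renaming of the free variables. -/
def rename : (ℕ → ℕ) → Term S → Term S
  | _, const c => const c
  | ρ, var n => var (ρ n)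
  | ρ, lam t => lam (rename (upRen ρ) t)
  | ρ, app t u => app (rename ρ t) (rename ρ u)
  | ρ, box t => box (rename ρ t)
  | ρ, letBox u t => letBox (rename ρ u) (rename (upRen ρ) t)

/-- Weakening by `k` innermost variables. -/
def shift (k : ℕ) (t : Term S) : Term S := t.rename (· + k)

/-- Extend a substitution below a binder. -/
def upSubst (σ : ℕ → Term S) : ℕ → Term S
  | 0 => var 0
  | n + 1 => (σ n).shift 1

/-- Capture-avoiding parallel substitution. -/
def subst : (ℕ → Term S) → Term S → Term S
  | _, const c => const c
  | σ, var n => σ n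
  | σ, lam t => lam (subst (upSubst σ) t)
  | σ, app t u => app (subst σ t) (subst σ u)
  | σ, box t => box (subst σ t)
  | σ, letBox u t => letBox (subst σ u) (subst (upSubst σ) t)

/-- `wrapLets [s₁, …, sₖ] t` is `L⟨t⟩` for the context
`L = let !x₁ = s₁ in … let !xₖ = sₖ in ⟨·⟩`. -/
def wrapLets : List (Term S) → Term S → Term S
  | [], t => t
  | s :: L, t => letBox s (wrapLets L t)

/-- The substitution that maps the variable `0` to `u`, and the variable `n + 1` to the
variable `n + k`. -/
def single (u : Term S) (k : ℕ) : ℕ → Term S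
  | 0 => u
  | n + 1 => var (n + k)

/-- `β`-reduction at a distance, in any context. The two root rules are
`L⟨λx. t⟩ u ⟶ L⟨t{x:=u}⟩` and `let !x = L⟨!u⟩ in t ⟶ L⟨t{x:=u}⟩`; the term that enters the scope
of the `let`-binders of `L` (`u` in the former, `t` in the latter) has to be weakened. -/
inductive Beta : Term S → Term S → Prop
  | lam (L : List (Term S)) (t u : Term S) :
      Beta (app (wrapLets L (lam t)) u) (wrapLets L (t.subst (single (u.shift L.length) 0)))
  | letBox (L : List (Term S)) (u t : Term S) :
      Beta (letBox (wrapLets L (box u)) t) (wrapLets L (t.subst (single u L.length)))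
  | underLam {t t' : Term S} (h : Beta t t') : Beta (.lam t) (.lam t')
  | appLeft {t t' : Term S} (u : Term S) (h : Beta t t') : Beta (app t u) (app t' u)
  | appRight (t : Term S) {u u' : Term S} (h : Beta u u') : Beta (app t u) (app t u')
  | underBox {t t' : Term S} (h : Beta t t') : Beta (box t) (box t')
  | letArg {u u' : Term S} (t : Term S) (h : Beta u u') : Beta (.letBox u t) (.letBox u' t)
  | letBody (u : Term S) {t t' : Term S} (h : Beta t t') : Beta (.letBox u t) (.letBox u t')

/-- The canonical encoding of trees: `c(τ₁, …, τₖ)` is encoded as `c τ₁ … τₖ`. -/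
def encode : GroundTree S → Term S
  | .leaf x => x.elim
  | .node c ts => (List.ofFn fun i => encode (ts i)).foldl app (const c)

end Term

/-! ### Typing -/

/-- Assignments of types to (de Bruijn) variables; `none` for an undeclared variable. -/
abbrev TyCtx : Type := ℕ → Option Ty

namespace TyCtx

/-- The empty context. -/
def empty : TyCtx := fun _ => none

/-- The context below a binder, whose variable is declared as given by the first argument. -/
def cons (a : Option Ty) (Γ : TyCtx) : TyCtx
  | 0 => a
  | n + 1 => Γ n

/-- `Φ` is the disjoint union of `Φ₁` and `Φ₂`. -/
def IsDisjointUnion (Φ Φ₁ Φ₂ : TyCtx) : Prop :=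
  ∀ n, (Φ₁ n = Φ n ∧ Φ₂ n = none) ∨ (Φ₁ n = none ∧ Φ₂ n = Φ n)

end TyCtx

/-- Typing derivations of `Θ | Φ ⊢ t : A`, with unrestricted variables in `Θ` and affine variables
in `Φ`. A constant `c` has type `o ⊸ ⋯ ⊸ o ⊸ o`, with `rank c` arguments. Weakening of the affine
variables is built into the rules for constants, variables and boxes. -/
inductive Deriv {S : RankedAlphabet.{u}} : TyCtx → TyCtx → Term S → Ty → Type u
  | const (Θ Φ : TyCtx) (c : S.Letter) : Deriv Θ Φ (.const c) (Ty.firstOrder (S.rank c))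
  | affVar (Θ Φ : TyCtx) (n : ℕ) (A : Ty) (h : Φ n = some A) : Deriv Θ Φ (.var n) A
  | unrVar (Θ Φ : TyCtx) (n : ℕ) (A : Ty) (h : Θ n = some A) : Deriv Θ Φ (.var n) A
  | lam {Θ Φ : TyCtx} {t : Term S} {A B : Ty} (d : Deriv (.cons none Θ) (.cons (some A) Φ) t B) :
      Deriv Θ Φ (.lam t) (.arrow A B)
  | app {Θ Φ Φ₁ Φ₂ : TyCtx} {t u : Term S} {A B : Ty} (h : Φ.IsDisjointUnion Φ₁ Φ₂)
      (d : Deriv Θ Φ₁ t (.arrow A B)) (e : Deriv Θ Φ₂ u A) : Deriv Θ Φ (.app t u) B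
  | box {Θ : TyCtx} (Φ : TyCtx) {t : Term S} {A : Ty} (d : Deriv Θ .empty t A) :
      Deriv Θ Φ (.box t) (.bang A)
  | letBox {Θ Φ Φ₁ Φ₂ : TyCtx} {t u : Term S} {A B : Ty} (h : Φ.IsDisjointUnion Φ₁ Φ₂)
      (d : Deriv Θ Φ₁ u (.bang A)) (e : Deriv (.cons (some A) Θ) (.cons none Φ₂) t B) :
      Deriv Θ Φ (.letBox u t) B

namespace Deriv

variable {S : RankedAlphabet.{u}}

/-- Every subterm has a purely affine type. (So there is no box and no `let` in the term.) -/
def PurelyAffine {Θ Φ : TyCtx} {t : Term S} {C : Ty} : Deriv Θ Φ t C → Prop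
  | const _ _ _ => C.PurelyAffine
  | affVar _ _ _ _ _ => C.PurelyAffine
  | unrVar _ _ _ _ _ => C.PurelyAffine
  | lam d => C.PurelyAffine ∧ d.PurelyAffine
  | app _ d e => C.PurelyAffine ∧ d.PurelyAffine ∧ e.PurelyAffine
  | box _ d => C.PurelyAffine ∧ d.PurelyAffine
  | letBox _ d e => C.PurelyAffine ∧ d.PurelyAffine ∧ e.PurelyAffine

/-- The condition of almost pure affineness on a single judgment: the type is almost purely affine,
and all unrestricted variables have type `o`. -/
def Admissible (Θ : TyCtx) (C : Ty) : Prop :=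
  C.AlmostPurelyAffine ∧ ∀ n A, Θ n = some A → A = Ty.o

/-- Every subterm has an almost purely affine type in a context whose unrestricted variables have
type `o`, and every subterm in a box is purely affine. -/
def AlmostPurelyAffine {Θ Φ : TyCtx} {t : Term S} {C : Ty} : Deriv Θ Φ t C → Prop
  | const _ _ _ => Admissible Θ C
  | affVar _ _ _ _ _ => Admissible Θ C
  | unrVar _ _ _ _ _ => Admissible Θ C
  | lam d => Admissible Θ C ∧ d.AlmostPurelyAffine
  | app _ d e => Admissible Θ C ∧ d.AlmostPurelyAffine ∧ e.AlmostPurelyAffine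
  | box _ d => Admissible Θ C ∧ d.PurelyAffine ∧ d.AlmostPurelyAffine
  | letBox _ d e => Admissible Θ C ∧ d.AlmostPurelyAffine ∧ e.AlmostPurelyAffine

end Deriv

/-- `v : o` (in empty contexts) is almost purely affine. -/
def Term.IsAlmostPurelyAffine {S : RankedAlphabet.{u}} (v : Term S) : Prop :=
  ∃ d : Deriv TyCtx.empty TyCtx.empty v Ty.o, d.AlmostPurelyAffine

/-! ### The Interaction Abstract Machine -/

/-- One layer of a context: `λx. ⟨·⟩`, `⟨·⟩ u`, `t ⟨·⟩`, `!⟨·⟩`, `let !x = ⟨·⟩ in t`,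
`let !x = u in ⟨·⟩`. -/
inductive Frame (S : RankedAlphabet.{u}) : Type u
  | lam : Frame S
  | appL (u : Term S) : Frame S
  | appR (t : Term S) : Frame S
  | box : Frame S
  | letArg (t : Term S) : Frame S
  | letBody (u : Term S) : Frame S

/-- Fill the hole of a layer; the variables of the filler may be captured. -/
def Frame.fill {S : RankedAlphabet.{u}} : Frame S → Term S → Term S
  | lam, t => .lam t
  | appL u, t => .app t u
  | appR t, u => .app t u
  | box, t => .box t
  | letArg t, u => .letBox u t
  | letBody u, t => .letBox u t

/-- `plug C t` is `C⟨t⟩`, where the context `C` is given by its layers, the innermost one first. -/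
def plug {S : RankedAlphabet.{u}} : List (Frame S) → Term S → Term S
  | [], t => t
  | f :: C, t => plug C (f.fill t)

inductive Direction : Type
  | down : Direction
  | up : Direction

/-- The symbols `𝗉` and `∘` of tapes. -/
inductive Token : Type
  | p : Token
  | circ : Token

/-- Configurations `(d, t, C, T)` with `C⟨t⟩ = v`. -/
structure Config {S : RankedAlphabet.{u}} (v : Term S) : Type u where
  dir : Direction
  focus : Term S
  ctx : List (Frame S)
  tape : List Token
  plug_eq : plug ctx focus = v

/-- `dropP n T` is `T'` if `T = 𝗉ⁿ·T'`, and undefined if `T` is not of this form. -/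
def dropP : ℕ → List Token → Option (List Token)
  | 0, T => some T
  | n + 1, .p :: T => dropP n T
  | _ + 1, _ => none

namespace Config

variable {S : RankedAlphabet.{u}} {v : Term S}

/-- The jump from a variable occurrence `x` to its binder, with tape `T`. It is called with `n` the
index of `x` (relatively to the current subterm `t`), and moves `t` outwards until it meets the
binder of `x`:
`C⟨λx. D⟨↓x⟩⟩, T ↦ C⟨↑(λx. D⟨x⟩)⟩, ∘·T` and
`C⟨let !x = u in D⟨↓x⟩⟩, T ↦ C⟨let !x = ↓u in D⟨x⟩⟩, T`. -/
def toBinder (T : List Token) :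
    ℕ → (t : Term S) → (C : List (Frame S)) → plug C t = v → Option (Config v)
  | _, _, [], _ => none
  | 0, t, .lam :: C, h => some ⟨.up, .lam t, C, .circ :: T, h⟩
  | n + 1, t, .lam :: C, h => toBinder T n (.lam t) C h
  | 0, t, .letBody u :: C, h => some ⟨.down, u, .letArg t :: C, T, h⟩
  | n + 1, t, .letBody u :: C, h => toBinder T n (.letBox u t) C h
  | n, t, .appL u :: C, h => toBinder T n (.app t u) C h
  | n, u, .appR t :: C, h => toBinder T n (.app t u) C h
  | n, t, .box :: C, h => toBinder T n (.box t) C h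
  | n, u, .letArg t :: C, h => toBinder T n (.letBox u t) C h

/-- The jump from a binder to the occurrence of its variable in its body, arriving upwards on this
occurrence with tape `T`; undefined if there is no occurrence. The index `n` is that of the variable
in the current subterm `t`. (Only used for `λ`-bound variables, which occur at most once in
well-typed terms.) -/
def toOccurrence (T : List Token) :
    ℕ → (t : Term S) → (C : List (Frame S)) → plug C t = v → Option (Config v)
  | _, .const _, _, _ => none
  | n, .var m, C, h => if m = n then some ⟨.up, .var m, C, T, h⟩ else none
  | n, .lam t, C, h => toOccurrence T (n + 1) t (.lam :: C) h
  | n, .app t u, C, h =>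
      (toOccurrence T n t (.appL u :: C) h).or (toOccurrence T n u (.appR t :: C) h)
  | n, .box t, C, h => toOccurrence T n t (.box :: C) h
  | n, .letBox u t, C, h =>
      (toOccurrence T n u (.letArg t :: C) h).or (toOccurrence T (n + 1) t (.letBody u :: C) h)

/-- The computation-step function of the almost purely affine IAM. -/
def step : Config v → Option (Tree S (Config v))
  -- `C⟨↓(t u)⟩, T ↦ C⟨↓t u⟩, 𝗉·T`
  | ⟨.down, .app t u, C, T, h⟩ => some (.leaf ⟨.down, t, .appL u :: C, .p :: T, h⟩)
  -- `C⟨↓(λx. t)⟩, 𝗉·T ↦ C⟨λx. ↓t⟩, T`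
  | ⟨.down, .lam t, C, .p :: T, h⟩ => some (.leaf ⟨.down, t, .lam :: C, T, h⟩)
  -- `C⟨↓(λx. D⟨x⟩)⟩, ∘·T ↦ C⟨λx. D⟨↑x⟩⟩, T`
  | ⟨.down, .lam t, C, .circ :: T, h⟩ => (toOccurrence T 0 t (.lam :: C) h).map .leaf
  | ⟨.down, .lam _, _, [], _⟩ => none
  -- the two rules for bound variables
  | ⟨.down, .var n, C, T, h⟩ => (toBinder T n (.var n) C h).map .leaf
  -- `C⟨↓c⟩, 𝗉ᵏ·T ↦ c((C⟨↑c⟩, ∘·T), (C⟨↑c⟩, 𝗉·∘·T), …, (C⟨↑c⟩, 𝗉ᵏ⁻¹·∘·T))` with `k = rank c`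
  | ⟨.down, .const c, C, T, h⟩ =>
      (dropP (S.rank c) T).map fun T' =>
        .node c fun i => .leaf ⟨.up, .const c, C, List.replicate i.val .p ++ .circ :: T', h⟩
  -- `C⟨↓(let !x = u in t)⟩, T ↦ C⟨let !x = u in ↓t⟩, T`
  | ⟨.down, .letBox u t, C, T, h⟩ => some (.leaf ⟨.down, t, .letBody u :: C, T, h⟩)
  -- `C⟨↓!t⟩, T ↦ C⟨!↓t⟩, T`
  | ⟨.down, .box t, C, T, h⟩ => some (.leaf ⟨.down, t, .box :: C, T, h⟩)
  -- `C⟨↑t u⟩, 𝗉·T ↦ C⟨↑(t u)⟩, T`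
  | ⟨.up, t, .appL u :: C, .p :: T, h⟩ => some (.leaf ⟨.up, .app t u, C, T, h⟩)
  -- `C⟨↑t u⟩, ∘·T ↦ C⟨t ↓u⟩, T`
  | ⟨.up, t, .appL u :: C, .circ :: T, h⟩ => some (.leaf ⟨.down, u, .appR t :: C, T, h⟩)
  | ⟨.up, _, .appL _ :: _, [], _⟩ => none
  -- `C⟨t ↑u⟩, T ↦ C⟨↓t u⟩, ∘·T`
  | ⟨.up, u, .appR t :: C, T, h⟩ => some (.leaf ⟨.down, t, .appL u :: C, .circ :: T, h⟩)
  -- `C⟨λx. ↑t⟩, T ↦ C⟨↑(λx. t)⟩, 𝗉·T`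
  | ⟨.up, t, .lam :: C, T, h⟩ => some (.leaf ⟨.up, .lam t, C, .p :: T, h⟩)
  -- `C⟨let !x = u in ↑t⟩, T ↦ C⟨↑(let !x = u in t)⟩, T`
  | ⟨.up, t, .letBody u :: C, T, h⟩ => some (.leaf ⟨.up, .letBox u t, C, T, h⟩)
  -- no rule
  | ⟨.up, _, .letArg _ :: _, _, _⟩ => none
  | ⟨.up, _, .box :: _, _, _⟩ => none
  | ⟨.up, _, [], _, _⟩ => none

end Config

/-- The almost purely affine IAM on the term `v`. -/
def APAIAM {S : RankedAlphabet.{u}} (v : Term S) : TreeMachine.{u, u} S where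
  Conf := Config v
  init := ⟨.down, v, [], [], rfl⟩
  step := Config.step

end AffineIAM

/-! Both the normal form and the machine are compared with one set-theoretic model: `o` denotes the
set of trees, `⊸` the full function space, and `!` nothing at all. The denotation of `v` is then a
tree, and this is the `τ` of the theorem.

On the side of reduction, a logical relation (`HasDen.reducible`) shows that a closed term of type
`o` reduces to the encoding of its denotation. Reduction preserves denotations (`HasDen.beta`), so
every reduct of `v` still reduces to that same encoding. Uniqueness of the normal form follows, with
neither confluence nor strong normalization.

On the side of the machine, the relation "this configuration evaluates to that tree", seen as a
function of the tape, is an oracle attached to each position of `v`. The transition rules make these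
oracles satisfy local constraints that follow the syntax (`Config.solves_machine`). Conversely,
realizability shows that any oracles satisfying the constraints answer the empty tape at the root
with the denotation (`Deriv.AlmostPurelyAffine.exists_realizes`). Since evaluation is defined
inductively, termination of the machine comes with this.

Affineness makes the jump from a `λ` to the occurrence of its variable well defined. The restriction
of `!` to `o` is what lets boxes be copied without any memory: at type `o` a single query is asked,
and nothing leaves the box upwards. -/

namespace AffineIAM

universe u v

/-! ### Evaluation of tree-generating machines -/

namespace TreeMachine

variable {S : RankedAlphabet.{u}}

/-- Big-step evaluation of a tree whose leaves are configurations. -/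
inductive EvalsTo (M : TreeMachine.{u, v} S) : Tree S M.Conf → GroundTree S → Prop
  | leaf {κ : M.Conf} {t : Tree S M.Conf} {τ : GroundTree S} (h : M.step κ = some t)
      (ht : EvalsTo M t τ) : EvalsTo M (.leaf κ) τ
  | node (c : S.Letter) (ts : Fin (S.rank c) → Tree S M.Conf)
      (τs : Fin (S.rank c) → GroundTree S) (h : ∀ i, EvalsTo M (ts i) (τs i)) :
      EvalsTo M (.node c ts) (.node c τs)

variable {M : TreeMachine.{u, v} S}

theorem evalsTo_leaf_iff {κ : M.Conf} {t : Tree S M.Conf} (h : M.step κ = some t)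
    (τ : GroundTree S) : M.EvalsTo (.leaf κ) τ ↔ M.EvalsTo t τ := by
  constructor
  · rintro (⟨h', ht⟩ | _)
    rw [h] at h'
    cases h'
    exact ht
  · exact .leaf h

/-- A rewriting step touches one child only, so the children are treated one after another, by
induction on the set of those already rewritten. -/
theorem reflTransGen_node (c : S.Letter) (ts ts' : Fin (S.rank c) → Tree S M.Conf)
    (h : ∀ i, Relation.ReflTransGen M.Rewrites (ts i) (ts' i)) :
    Relation.ReflTransGen M.Rewrites (.node c ts) (.node c ts') := by
  have one : ∀ (ts : Fin (S.rank c) → Tree S M.Conf) (i : Fin (S.rank c)) (t : Tree S M.Conf),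
      Relation.ReflTransGen M.Rewrites (ts i) t →
        Relation.ReflTransGen M.Rewrites (.node c ts) (.node c (Function.update ts i t)) := by
    intro ts i t h
    induction h with
    | refl => rw [Function.update_eq_self]
    | tail _ hs ih =>
      refine ih.tail ?_
      have := Rewrites.node c (Function.update ts i _) i (by rwa [Function.update_self])
      rwa [Function.update_idem] at this
  have all : ∀ s : Finset (Fin (S.rank c)), Relation.ReflTransGen M.Rewrites (.node c ts)
      (.node c fun i => if i ∈ s then ts' i else ts i) := by
    intro s
    induction s using Finset.induction with
    | empty => simpa using Relation.ReflTransGen.refl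
    | insert a s ha ih =>
      have key := one (fun i => if i ∈ s then ts' i else ts i) a (ts' a) (by simpa [ha] using h a)
      have e : Function.update (fun i => if i ∈ s then ts' i else ts i) a (ts' a) =
          fun i => if i ∈ insert a s then ts' i else ts i := by
        funext i
        by_cases hi : i = a
        · subst hi; simp
        · simp [hi]
      rw [e] at key
      exact ih.trans key
  simpa using all Finset.univ

theorem EvalsTo.reflTransGen {t : Tree S M.Conf} {τ : GroundTree S} (h : M.EvalsTo t τ) :
    Relation.ReflTransGen M.Rewrites t (τ.embed M.Conf) := by
  induction h with
  | leaf h _ ih => exact ih.head (.leaf h)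
  | node c ts τs _ ih => exact reflTransGen_node c _ _ ih

/-- The step is a function, so a tree cannot be rewritten away from its value. This plays the part
of confluence in the uniqueness of the output. -/
theorem EvalsTo.of_rewrites {t t' : Tree S M.Conf} (r : M.Rewrites t t') :
    ∀ {τ : GroundTree S}, M.EvalsTo t τ → M.EvalsTo t' τ := by
  induction r with
  | leaf h => exact fun e => (evalsTo_leaf_iff h _).1 e
  | node c ts i _ ih =>
    rintro _ (_ | ⟨_, _, τs, h⟩)
    refine .node _ _ _ fun j => ?_
    by_cases hj : j = i
    · subst hj
      simpa using ih (h j)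
    · simpa [hj] using h j

theorem not_rewrites_embed (τ : GroundTree S) (t : Tree S M.Conf) :
    ¬ M.Rewrites (τ.embed M.Conf) t := by
  induction τ generalizing t with
  | leaf x => exact x.elim
  | node c ts ih =>
    intro h
    rw [GroundTree.embed] at h
    cases h with
    | node _ _ i h => exact ih i _ h

theorem EvalsTo.eq_embed {t : Tree S M.Conf} {τ : GroundTree S} (h : M.EvalsTo t τ)
    (hn : ∀ t', ¬ M.Rewrites t t') : t = τ.embed M.Conf := by
  induction h with
  | leaf h _ _ => exact (hn _ (.leaf h)).elim
  | node c ts τs _ ih =>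
    rw [GroundTree.embed]
    congr 1
    funext i
    exact ih i fun t' r => hn _ (.node c ts i r)

theorem EvalsTo.isOutput {τ : GroundTree S} (h : M.EvalsTo (.leaf M.init) τ) : M.IsOutput τ := by
  refine ⟨⟨h.reflTransGen, not_rewrites_embed τ⟩, fun t ht hn => ?_⟩
  refine EvalsTo.eq_embed ?_ hn
  clear hn
  induction ht with
  | refl => exact h
  | tail _ r ih => exact ih.of_rewrites r

end TreeMachine

/-! ### Renamings and substitutions -/

namespace Term

variable {S : RankedAlphabet.{u}}

/-- Extend a sequence by a new first element. -/
def scons {α : Type v} (a : α) (f : ℕ → α) : ℕ → α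
  | 0 => a
  | n + 1 => f n

theorem upRen_id : upRen id = id := by
  funext n; cases n <;> rfl

theorem upRen_comp (r s : ℕ → ℕ) : upRen r ∘ upRen s = upRen (r ∘ s) := by
  funext n; cases n <;> rfl

theorem upSubst_comp_upRen (σ : ℕ → Term S) (r : ℕ → ℕ) :
    upSubst σ ∘ upRen r = upSubst (σ ∘ r) := by
  funext n; cases n <;> rfl

theorem upSubst_var : upSubst (var : ℕ → Term S) = var := by
  funext n; cases n <;> rfl

theorem rename_id (t : Term S) : t.rename id = t := by
  induction t <;> simp_all [rename, upRen_id]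

theorem rename_rename (t : Term S) (r s : ℕ → ℕ) :
    (t.rename s).rename r = t.rename (r ∘ s) := by
  induction t generalizing r s <;> simp_all [rename, upRen_comp]

theorem subst_rename (t : Term S) (σ : ℕ → Term S) (r : ℕ → ℕ) :
    (t.rename r).subst σ = t.subst (σ ∘ r) := by
  induction t generalizing σ r <;> simp_all [rename, subst, upSubst_comp_upRen]

theorem rename_comp_upSubst (σ : ℕ → Term S) (r : ℕ → ℕ) :
    rename (upRen r) ∘ upSubst σ = upSubst (rename r ∘ σ) := by
  funext n
  cases n with
  | zero => rfl
  | succ n => simp only [Function.comp, upSubst, shift, rename_rename]; rfl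

theorem rename_subst (t : Term S) (σ : ℕ → Term S) (r : ℕ → ℕ) :
    (t.subst σ).rename r = t.subst (rename r ∘ σ) := by
  induction t generalizing σ r <;> simp_all [rename, subst, rename_comp_upSubst]

theorem subst_comp_upSubst (σ σ' : ℕ → Term S) :
    subst (upSubst σ) ∘ upSubst σ' = upSubst (subst σ ∘ σ') := by
  funext n
  cases n with
  | zero => rfl
  | succ n => simp only [Function.comp, upSubst, shift, subst_rename, rename_subst]; rfl

theorem subst_subst (t : Term S) (σ σ' : ℕ → Term S) :
    (t.subst σ').subst σ = t.subst (subst σ ∘ σ') := by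
  induction t generalizing σ σ' <;> simp_all [subst, subst_comp_upSubst]

theorem subst_var (t : Term S) : t.subst var = t := by
  induction t <;> simp_all [subst, upSubst_var]

theorem shift_zero (t : Term S) : t.shift 0 = t := rename_id t

theorem shift_shift (t : Term S) (m n : ℕ) : (t.shift m).shift n = t.shift (n + m) := by
  rw [shift, shift, rename_rename, shift]
  congr 1
  funext i
  simp only [Function.comp]
  omega

/-- This is the shape of the contractum when a redex appears inside a substituted term, as in the
logical relation. -/
theorem subst_single_upSubst (t u : Term S) (σ : ℕ → Term S) :
    (t.subst (upSubst σ)).subst (single u 0) = t.subst (scons u σ) := by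
  rw [subst_subst]
  congr 1
  funext n
  cases n with
  | zero => rfl
  | succ n =>
    simp only [Function.comp, upSubst, shift, subst_rename, scons]
    exact subst_var _

theorem subst_single_rename (t u : Term S) (m : ℕ) :
    (t.rename (upRen (· + 1))).subst (single u m) = t.subst (single u (m + 1)) := by
  rw [subst_rename]
  congr 1
  funext n
  cases n with
  | zero => rfl
  | succ n => simp only [Function.comp, upRen, single]; congr 1; omega

end Term

open Term (scons)

/-! ### Set-theoretic denotations -/

/-- The set-theoretic interpretation of types. -/
def Ty.Den (S : RankedAlphabet.{u}) : Ty → Type u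
  | .o => GroundTree S
  | .arrow A B => A.Den S → B.Den S
  | .bang A => A.Den S

/-- Valuations of the variables typed by `Γ`. -/
abbrev Env (S : RankedAlphabet.{u}) (Γ : ℕ → Ty) : Type u := ∀ n, (Γ n).Den S

namespace Env

variable {S : RankedAlphabet.{u}} {Γ : ℕ → Ty} {A : Ty}

def cons (a : A.Den S) (ρ : Env S Γ) : Env S (scons A Γ)
  | 0 => a
  | n + 1 => ρ n

def tail (ρ : Env S (scons A Γ)) : Env S Γ := fun n => ρ (n + 1)

end Env

/-- The curried form of an operation on trees. -/
def curriedDen {S : RankedAlphabet.{u}} :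
    (n : ℕ) → ((Fin n → GroundTree S) → GroundTree S) → (Ty.firstOrder n).Den S
  | 0, F => F Fin.elim0
  | n + 1, F => fun a : GroundTree S => curriedDen n fun ts => F (Fin.cons a ts)

/-- Simple (non-affine) typing of a term whose free variables are `< k`, together with the
denotation of the term. -/
inductive HasDen {S : RankedAlphabet.{u}} :
    (k : ℕ) → (Γ : ℕ → Ty) → Term S → (A : Ty) → (Env S Γ → A.Den S) → Prop
  | const {k Γ} (c : S.Letter) :
      HasDen k Γ (.const c) (Ty.firstOrder (S.rank c)) fun _ => curriedDen _ (Tree.node c)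
  | var {k Γ} (n : ℕ) (h : n < k) : HasDen k Γ (.var n) (Γ n) fun ρ => ρ n
  | lam {k Γ t A B f} (h : HasDen (k + 1) (scons A Γ) t B f) :
      HasDen k Γ (.lam t) (.arrow A B) fun ρ a => f (ρ.cons a)
  | app {k Γ t u A B f g} (h : HasDen k Γ t (.arrow A B) f) (h' : HasDen k Γ u A g) :
      HasDen k Γ (.app t u) B fun ρ => f ρ (g ρ)
  | box {k Γ t A f} (h : HasDen k Γ t A f) : HasDen k Γ (.box t) (.bang A) f
  | letBox {k Γ t u A B f g} (h : HasDen k Γ u (.bang A) g)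
      (h' : HasDen (k + 1) (scons A Γ) t B f) :
      HasDen k Γ (.letBox u t) B fun ρ => f (ρ.cons (g ρ))

/-! ### Oracles and the constraints that a term puts on them -/

/-- An oracle associates possible answers with tapes. -/
abbrev Oracle (S : RankedAlphabet.{u}) : Type u := List Token → GroundTree S → Prop

/-- The constraints put by the machine on the answers to queries sent through the interface of a
subterm: `D` answers the queries that enter the subterm downwards, `U` those that leave it upwards,
`X n` those that leave it through the variable `n`, and `I n` those that enter it at an occurrence
of the variable `n`. -/
def Solves {S : RankedAlphabet.{u}} : Term S → (D U : Oracle S) → (X I : ℕ → Oracle S) → Prop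
  | .const c, D, U, _, _ => ∀ (T : List Token) (ts : Fin (S.rank c) → GroundTree S),
      (∀ i, U (List.replicate i.val .p ++ .circ :: T) (ts i)) →
        D (List.replicate (S.rank c) .p ++ T) (.node c ts)
  | .var n, D, U, X, I => X n ≤ D ∧ U ≤ I n
  | .lam t, D, U, X, I =>
      Solves t (fun T => D (.p :: T)) (fun T => U (.p :: T)) (scons (fun T => U (.circ :: T)) X)
        (scons (fun T => D (.circ :: T)) I)
  | .app t u, D, U, X, I => ∃ D' U', D = (fun T => D' (.p :: T)) ∧ U = (fun T => U' (.p :: T)) ∧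
      Solves t D' U' X I ∧ Solves u (fun T => U' (.circ :: T)) (fun T => D' (.circ :: T)) X I
  -- No rule moves upwards out of a box, so the two upward oracles are unrelated.
  | .box t, D, _, X, I => ∃ U', Solves t D U' X I
  -- Every occurrence of the bound variable sends its query down into `u`, hence `D'`. No rule
  -- enters such an occurrence, hence the void constraint `⊤`.
  | .letBox u t, D, U, X, I => ∃ D' U', Solves u D' U' X I ∧ Solves t D U (scons D' X) (scons ⊤ I)

/-! ### Realizability -/

/-- A behavior, given by the pairs of oracles `(D, U)` that are compatible with it. -/
abbrev Behavior (S : RankedAlphabet.{u}) : Type u := Oracle S → Oracle S → Prop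

/-- Composition of a behavior of functional type with a behavior for its argument. -/
def Behavior.comp {S : RankedAlphabet.{u}} (P Q : Behavior S) : Behavior S := fun D U =>
  ∃ D' U', D = (fun T => D' (.p :: T)) ∧ U = (fun T => U' (.p :: T)) ∧ P D' U' ∧
    Q (fun T => U' (.circ :: T)) (fun T => D' (.circ :: T))

/-- `Realizes A P a`: the behavior `P` computes the semantic value `a` of type `A`. -/
def Realizes {S : RankedAlphabet.{u}} : (A : Ty) → Behavior S → A.Den S → Prop
  | .o, P, a => ∀ D U, P D U → D [] a
  | .arrow A B, P, f => ∀ (Q : Behavior S) (a : A.Den S), Realizes A Q a →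
      Realizes B (P.comp Q) (f a)
  | .bang A, P, a => Realizes A P a

variable {S : RankedAlphabet.{u}}

/-- Realizability only asks `D` to contain certain answers, so it survives when `D` grows and `U`,
the answers granted by the surroundings, shrinks. -/
theorem Realizes.mono {A : Ty} {P P' : Behavior S} {a : A.Den S} (h : Realizes A P a)
    (hP : ∀ D U, P' D U → ∃ D₀ U₀, P D₀ U₀ ∧ D₀ ≤ D ∧ U ≤ U₀) : Realizes A P' a := by
  induction A generalizing P P' with
  | o =>
    intro D U hDU
    obtain ⟨D₀, U₀, h₀, hD, _⟩ := hP D U hDU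
    exact hD _ _ (h D₀ U₀ h₀)
  | bang A ih => exact ih (a := a) h hP
  | arrow A B ihA ihB =>
    intro Q b hb
    -- The argument's behavior is first closed under the same order, so that it still accepts the
    -- oracles `D₀`, `U₀` of `P`.
    refine ihB (h (fun D U => ∃ D₀ U₀, Q D₀ U₀ ∧ D₀ ≤ D ∧ U ≤ U₀) b (ihA hb fun _ _ h => h)) ?_
    rintro _ _ ⟨D, U, rfl, rfl, hDU, hQ⟩
    obtain ⟨D₀, U₀, h₀, hD, hU⟩ := hP D U hDU
    exact ⟨_, _, ⟨D₀, U₀, rfl, rfl, h₀, _, _, hQ, fun T => hU _, fun T => hD _⟩,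
      fun T => hD _, fun T => hU _⟩

/-- Each application strips one `𝗉` from the tapes, so the query `𝗉ⁱ·∘` ends up asking the `i`-th
argument for its value on the empty tape. -/
theorem realizes_curriedDen (n : ℕ) (P : Behavior S) (F : (Fin n → GroundTree S) → GroundTree S)
    (h : ∀ D U, P D U → ∀ ts, (∀ i : Fin n, U (List.replicate i.val .p ++ [.circ]) (ts i)) →
      D (List.replicate n .p) (F ts)) : Realizes (Ty.firstOrder n) P (curriedDen n F) := by
  induction n generalizing P with
  | zero => exact fun D U hDU => h D U hDU Fin.elim0 fun i => i.elim0
  | succ n ih =>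
    intro Q (a : GroundTree S) ha
    refine ih _ _ ?_
    rintro _ _ ⟨D, U, rfl, rfl, hDU, hQ⟩ ts hts
    refine h D U hDU (Fin.cons a ts) fun i => ?_
    cases i using Fin.cases with
    | zero => exact ha _ _ hQ
    | succ i => exact hts i

/-- The behavior computed by a term, in an environment of behaviors for the variables declared in
one of two contexts. -/
def Term.behavior (t : Term S) (Θ Φ : TyCtx) (Q : ℕ → Behavior S) : Behavior S := fun D U =>
  ∃ X I, Solves t D U X I ∧ ∀ n, (Θ n ≠ none ∨ Φ n ≠ none) → Q n (X n) (I n)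

theorem TyCtx.IsDisjointUnion.left_le {Φ Φ₁ Φ₂ : TyCtx} (h : Φ.IsDisjointUnion Φ₁ Φ₂) {n : ℕ}
    {A : Ty} (hA : Φ₁ n = some A) : Φ n = some A := by
  rcases h n with ⟨h₁, _⟩ | ⟨h₁, _⟩
  · rw [← h₁, hA]
  · simp [h₁] at hA

theorem TyCtx.IsDisjointUnion.right_le {Φ Φ₁ Φ₂ : TyCtx} (h : Φ.IsDisjointUnion Φ₁ Φ₂) {n : ℕ}
    {A : Ty} (hA : Φ₂ n = some A) : Φ n = some A := by
  rcases h n with ⟨_, h₂⟩ | ⟨_, h₂⟩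
  · simp [h₂] at hA
  · rw [← h₂, hA]

/-- The declarations of `Θ` and `Φ` are among those given by `k` and `Γ`. -/
def TyCtx.Compatible (k : ℕ) (Γ : ℕ → Ty) (Θ Φ : TyCtx) : Prop :=
  ∀ n A, (Θ n = some A ∨ Φ n = some A) → n < k ∧ Γ n = A

theorem TyCtx.Compatible.cons {k : ℕ} {Γ : ℕ → Ty} {Θ Φ : TyCtx} (h : Compatible k Γ Θ Φ)
    {A : Ty} {a b : Option Ty} (ha : a = none ∨ a = some A) (hb : b = none ∨ b = some A) :
    Compatible (k + 1) (scons A Γ) (.cons a Θ) (.cons b Φ) := by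
  intro n B hn
  cases n with
  | zero =>
    refine ⟨k.succ_pos, ?_⟩
    rcases ha with rfl | rfl <;> rcases hb with rfl | rfl <;>
      simp_all [TyCtx.cons, scons]
  | succ n => exact ⟨Nat.succ_lt_succ (h n B hn).1, (h n B hn).2⟩

theorem Deriv.AlmostPurelyAffine.admissible {Θ Φ : TyCtx} {t : Term S} {A : Ty}
    {d : Deriv Θ Φ t A} (h : d.AlmostPurelyAffine) : Deriv.Admissible Θ A := by
  cases d
  case lam => exact h.1
  case app => exact h.1
  case box => exact h.1
  case letBox => exact h.1
  all_goals exact h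

/-- Almost purely affine terms have a denotation, and it is realized by their behaviors. -/
theorem Deriv.AlmostPurelyAffine.exists_realizes {Θ Φ : TyCtx} {t : Term S} {A : Ty}
    {d : Deriv Θ Φ t A} (h : d.AlmostPurelyAffine) {k : ℕ} {Γ : ℕ → Ty}
    (hΓ : TyCtx.Compatible k Γ Θ Φ) :
    ∃ f, HasDen k Γ t A f ∧ ∀ (ρ : Env S Γ) (Q : ℕ → Behavior S),
      (∀ n, (Θ n ≠ none ∨ Φ n ≠ none) → Realizes (Γ n) (Q n) (ρ n)) →
        Realizes A (t.behavior Θ Φ Q) (f ρ) := by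
  induction d generalizing k Γ with
  | const Θ Φ c =>
    refine ⟨_, .const c, fun ρ Q hQ => realizes_curriedDen _ _ _ ?_⟩
    rintro D U ⟨X, I, hs, _⟩ ts hts
    simpa using hs [] ts hts
  | affVar Θ Φ n A hn =>
    obtain ⟨hk, rfl⟩ := hΓ n A (.inr hn)
    refine ⟨_, .var n hk, fun ρ Q hQ => ?_⟩
    have hn' : Θ n ≠ none ∨ Φ n ≠ none := .inr (by simp [hn])
    refine (hQ n hn').mono ?_
    rintro D U ⟨X, I, hs, hX⟩
    exact ⟨_, _, hX n hn', hs⟩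
  | unrVar Θ Φ n A hn =>
    obtain ⟨hk, rfl⟩ := hΓ n A (.inl hn)
    refine ⟨_, .var n hk, fun ρ Q hQ => ?_⟩
    have hn' : Θ n ≠ none ∨ Φ n ≠ none := .inl (by simp [hn])
    refine (hQ n hn').mono ?_
    rintro D U ⟨X, I, hs, hX⟩
    exact ⟨_, _, hX n hn', hs⟩
  | @lam Θ Φ t A B d ih =>
    obtain ⟨f, hf, hr⟩ := ih h.2 (hΓ.cons (A := A) (.inl rfl) (.inr rfl))
    refine ⟨_, .lam hf, fun ρ Q hQ R a ha => ?_⟩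
    refine (hr (ρ.cons a) (scons R Q) ?_).mono ?_
    · rintro (_ | n) hn
      · exact ha
      · exact hQ n hn
    · rintro _ _ ⟨D, U, rfl, rfl, ⟨X, I, hs, hX⟩, hR⟩
      refine ⟨_, _, ⟨_, _, hs, ?_⟩, le_rfl, le_rfl⟩
      rintro (_ | n) hn
      · exact hR
      · exact hX n hn
  | @app Θ Φ Φ₁ Φ₂ t u A B hΦ d e ihd ihe =>
    have m₁ : ∀ n, (Θ n ≠ none ∨ Φ₁ n ≠ none) → (Θ n ≠ none ∨ Φ n ≠ none) := fun n hn =>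
      hn.imp_right fun hn => by
        obtain ⟨A, hA⟩ := Option.ne_none_iff_exists'.1 hn
        simp [hΦ.left_le hA]
    have m₂ : ∀ n, (Θ n ≠ none ∨ Φ₂ n ≠ none) → (Θ n ≠ none ∨ Φ n ≠ none) := fun n hn =>
      hn.imp_right fun hn => by
        obtain ⟨A, hA⟩ := Option.ne_none_iff_exists'.1 hn
        simp [hΦ.right_le hA]
    obtain ⟨f, hf, hrf⟩ := ihd h.2.1 (k := k) (Γ := Γ)
      fun n A hn => hΓ n A (hn.imp_right hΦ.left_le)
    obtain ⟨g, hg, hrg⟩ := ihe h.2.2 (k := k) (Γ := Γ)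
      fun n A hn => hΓ n A (hn.imp_right hΦ.right_le)
    refine ⟨_, .app hf hg, fun ρ Q hQ => ?_⟩
    refine (hrf ρ Q (fun n hn => hQ n (m₁ n hn)) _ _
      (hrg ρ Q fun n hn => hQ n (m₂ n hn))).mono ?_
    rintro _ _ ⟨X, I, ⟨D, U, rfl, rfl, hst, hsu⟩, hX⟩
    exact ⟨_, _, ⟨D, U, rfl, rfl, ⟨X, I, hst, fun n hn => hX n (m₁ n hn)⟩,
      ⟨X, I, hsu, fun n hn => hX n (m₂ n hn)⟩⟩, le_rfl, le_rfl⟩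
  | @box Θ Φ t A d ih =>
    have m : ∀ n, (Θ n ≠ none ∨ TyCtx.empty n ≠ none) → (Θ n ≠ none ∨ Φ n ≠ none) := fun n hn =>
      .inl (hn.resolve_right (by simp [TyCtx.empty]))
    obtain ⟨f, hf, hr⟩ := ih h.2.2 (k := k) (Γ := Γ)
      fun n A hn => hΓ n A (.inl (hn.resolve_right (by simp [TyCtx.empty])))
    refine ⟨f, .box hf, fun ρ Q hQ => ?_⟩
    -- At type `o` realizability ignores the upward oracle, which is exactly what the box forgets.
    obtain rfl : A = .o := h.1.1
    have hr' := hr ρ Q fun n hn => hQ n (m n hn)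
    rintro D U ⟨X, I, ⟨U', hs⟩, hX⟩
    exact hr' D U' ⟨X, I, hs, fun n hn => hX n (m n hn)⟩
  | @letBox Θ Φ Φ₁ Φ₂ t u A B hΦ d e ihd ihe =>
    have m₁ : ∀ n, (Θ n ≠ none ∨ Φ₁ n ≠ none) → (Θ n ≠ none ∨ Φ n ≠ none) := fun n hn =>
      hn.imp_right fun hn => by
        obtain ⟨A, hA⟩ := Option.ne_none_iff_exists'.1 hn
        simp [hΦ.left_le hA]
    have m₂ : ∀ n, (Θ n ≠ none ∨ Φ₂ n ≠ none) → (Θ n ≠ none ∨ Φ n ≠ none) := fun n hn =>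
      hn.imp_right fun hn => by
        obtain ⟨A, hA⟩ := Option.ne_none_iff_exists'.1 hn
        simp [hΦ.right_le hA]
    obtain rfl : A = .o := h.2.1.admissible.1
    obtain ⟨g, hg, hrg⟩ := ihd h.2.1 (k := k) (Γ := Γ)
      fun n A hn => hΓ n A (hn.imp_right hΦ.left_le)
    obtain ⟨f, hf, hrf⟩ := ihe h.2.2 (k := k + 1) (Γ := scons .o Γ)
      (TyCtx.Compatible.cons (A := .o) (fun n A hn => hΓ n A (hn.imp_right hΦ.right_le))
        (.inr rfl) (.inl rfl))
    refine ⟨_, .letBox hg hf, fun ρ Q hQ => ?_⟩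
    have hrg' := hrg ρ Q fun n hn => hQ n (m₁ n hn)
    -- The behavior given to the bound variable demands only the answer to the empty tape. It
    -- ignores its second oracle, so it can serve any number of occurrences.
    refine (hrf (Env.cons (A := .o) (g ρ) ρ) (scons (fun D _ => D [] (g ρ)) Q) ?_).mono ?_
    · rintro (_ | n) hn
      · exact fun D U hD => hD
      · exact hQ n (m₂ n hn)
    · rintro D U ⟨X, I, ⟨D', U', hsu, hst⟩, hX⟩
      refine ⟨_, _, ⟨_, _, hst, ?_⟩, le_rfl, le_rfl⟩
      rintro (_ | n) hn
      · exact hrg' D' U' ⟨X, I, hsu, fun n hn => hX n (m₁ n hn)⟩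
      · exact hX n (m₂ n hn)

/-! ### The machine satisfies the constraints -/

theorem dropP_eq_some {n : ℕ} {T T' : List Token} :
    dropP n T = some T' ↔ T = List.replicate n .p ++ T' := by
  induction n generalizing T with
  | zero => simp [dropP, eq_comm]
  | succ n ih =>
    rcases T with _ | ⟨_ | _, T⟩ <;> simp [dropP, ih, List.replicate_succ]

namespace Config

variable {v : Term S}

/-- A derivation only uses declared variables. Since affine contexts are split disjointly, this
makes the search for an affine variable owned by the right component fail in the left one and fall
through. -/
theorem toOccurrence_eq_none {Θ Φ : TyCtx} {t : Term S} {A : Ty} (d : Deriv Θ Φ t A) {n : ℕ}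
    (hΘ : Θ n = none) (hΦ : Φ n = none) (T : List Token) (C : List (Frame S))
    (h : plug C t = v) : toOccurrence T n t C h = none := by
  induction d generalizing n C with
  | const => rfl
  | affVar Θ Φ m A hm =>
    have : m ≠ n := by rintro rfl; simp [hm] at hΦ
    simp [toOccurrence, this]
  | unrVar Θ Φ m A hm =>
    have : m ≠ n := by rintro rfl; simp [hm] at hΘ
    simp [toOccurrence, this]
  | lam d ih => exact ih (n := n + 1) hΘ hΦ _ _
  | app hu d e ihd ihe =>
    exact Option.or_eq_none_iff.2
      ⟨ihd hΘ (by have := hu n; grind) _ _, ihe hΘ (by have := hu n; grind) _ _⟩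
  | box Φ d ih => exact ih hΘ rfl _ _
  | letBox hu d e ihd ihe =>
    exact Option.or_eq_none_iff.2 ⟨ihd hΘ (by have := hu n; grind) _ _,
      ihe (n := n + 1) hΘ (by have := hu n; simp only [TyCtx.cons]; grind) _ _⟩

/-- The trees to which a possibly undefined configuration evaluates. -/
def EvalsTo (κ : Option (Config v)) (τ : GroundTree S) : Prop :=
  ∃ κ', κ = some κ' ∧ (APAIAM v).EvalsTo (.leaf κ') τ

theorem evalsTo_some {κ : Config v} {τ : GroundTree S} :
    EvalsTo (some κ) τ ↔ (APAIAM v).EvalsTo (.leaf κ) τ := by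
  simp [EvalsTo]

theorem evalsTo_none (τ : GroundTree S) : ¬ EvalsTo (none : Option (Config v)) τ := by
  simp [EvalsTo]

theorem evalsTo_le_or_left (κ κ' : Option (Config v)) : EvalsTo κ ≤ EvalsTo (κ.or κ') := by
  rintro τ ⟨κ, rfl, hτ⟩
  exact ⟨κ, rfl, hτ⟩

theorem evalsTo_le_or_right {κ : Option (Config v)} (h : κ = none) (κ' : Option (Config v)) :
    EvalsTo κ' ≤ EvalsTo (κ.or κ') := by
  rw [h]
  exact le_rfl

/-- This turns each rule that emits no letter into an equation between oracles. Failed jumps are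
included: a stuck configuration, like `none`, evaluates to nothing. -/
theorem evalsTo_of_step {κ : Config v} {κ' : Option (Config v)} (h : κ.step = κ'.map .leaf) :
    EvalsTo (some κ) = EvalsTo κ' := by
  funext τ
  refine propext ?_
  rw [evalsTo_some]
  cases κ' with
  | none =>
    refine iff_of_false ?_ (evalsTo_none τ)
    rintro (⟨h', _⟩ | _)
    exact absurd (h.symm.trans h') (by simp)
  | some κ' =>
    rw [evalsTo_some]
    exact TreeMachine.evalsTo_leaf_iff (M := APAIAM v) h τ

/-- The answers of the machine to downward queries to a subterm. -/
def downOracle (t : Term S) (C : List (Frame S)) (h : plug C t = v) : Oracle S :=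
  fun T => EvalsTo (some ⟨.down, t, C, T, h⟩)

/-- The answers of the machine to queries that leave a subterm upwards. -/
def upOracle (t : Term S) (C : List (Frame S)) (h : plug C t = v) : Oracle S :=
  fun T => EvalsTo (some ⟨.up, t, C, T, h⟩)

/-- The answers of the machine to queries that leave a subterm through a variable. -/
def varOracle (t : Term S) (C : List (Frame S)) (h : plug C t = v) (n : ℕ) : Oracle S :=
  fun T => EvalsTo (toBinder T n t C h)

/-- Each constraint is a transition rule read through `evalsTo_of_step`; only constants build a
node. The hypotheses on `I` reflect that only `λ`-bound variables are ever entered, at the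
occurrence found by `toOccurrence`; an unrestricted variable may have many occurrences, and is left
unconstrained. -/
theorem solves_machine {Θ Φ : TyCtx} {t : Term S} {A : Ty} (d : Deriv Θ Φ t A)
    (C : List (Frame S)) (h : plug C t = v) (I : ℕ → Oracle S)
    (hΘ : ∀ n, Θ n ≠ none → I n = ⊤)
    (hΦ : ∀ n, Φ n ≠ none → ∀ T, EvalsTo (toOccurrence T n t C h) ≤ I n T) :
    Solves t (downOracle t C h) (upOracle t C h) (varOracle t C h) I := by
  induction d generalizing C I with
  | const Θ Φ c =>
    intro T ts hts
    let κ (i : Fin (S.rank c)) : Config v :=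
      ⟨.up, .const c, C, List.replicate i.val .p ++ .circ :: T, h⟩
    have hstep : step ⟨.down, .const c, C, List.replicate (S.rank c) .p ++ T, h⟩ =
        some (.node c fun i => .leaf (κ i)) := by
      rw [step, dropP_eq_some.2 rfl]
      rfl
    exact evalsTo_some.2 (.leaf hstep (.node _ _ _ fun i => evalsTo_some.1 (hts i)))
  | affVar Θ Φ n A hn =>
    have hd : downOracle (.var n) C h = varOracle (.var n) C h n := by
      funext T
      exact evalsTo_of_step rfl
    refine ⟨hd.ge, fun T => ?_⟩
    have := hΦ n (by simp [hn]) T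
    simp only [toOccurrence, if_true] at this
    exact this
  | unrVar Θ Φ n A hn =>
    have hd : downOracle (.var n) C h = varOracle (.var n) C h n := by
      funext T
      exact evalsTo_of_step rfl
    refine ⟨hd.ge, ?_⟩
    rw [hΘ n (by simp [hn])]
    exact le_top
  | @lam Θ Φ t A B d ih =>
    have hD : downOracle t (.lam :: C) h = fun T => downOracle (.lam t) C h (.p :: T) := by
      funext T
      exact (evalsTo_of_step (κ' := some _) rfl).symm
    have hU : upOracle t (.lam :: C) h = fun T => upOracle (.lam t) C h (.p :: T) := by
      funext T
      exact evalsTo_of_step (κ' := some _) rfl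
    have hX : varOracle t (.lam :: C) h =
        scons (fun T => upOracle (.lam t) C h (.circ :: T)) (varOracle (.lam t) C h) := by
      funext n
      cases n <;> rfl
    have hs := ih (.lam :: C) h (scons (fun T => downOracle (.lam t) C h (.circ :: T)) I) ?_ ?_
    · rw [hD, hU, hX] at hs
      exact hs
    · rintro (_ | n) hn
      · exact absurd rfl hn
      · exact hΘ n hn
    · rintro (_ | n) hn T
      · exact (evalsTo_of_step (κ := ⟨.down, .lam t, C, .circ :: T, h⟩) rfl).ge
      · exact hΦ n hn T
  | @app Θ Φ Φ₁ Φ₂ t u A B hu d e ihd ihe =>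
    have hX : ∀ n, varOracle t (.appL u :: C) h n = varOracle (.app t u) C h n := by
      rintro (_ | n) <;> rfl
    have hX' : ∀ n, varOracle u (.appR t :: C) h n = varOracle (.app t u) C h n := by
      rintro (_ | n) <;> rfl
    have hD : downOracle u (.appR t :: C) h =
        fun T => upOracle t (.appL u :: C) h (.circ :: T) := by
      funext T
      exact (evalsTo_of_step (κ' := some _) rfl).symm
    have hU : upOracle u (.appR t :: C) h =
        fun T => downOracle t (.appL u :: C) h (.circ :: T) := by
      funext T
      exact evalsTo_of_step (κ' := some _) rfl
    refine ⟨downOracle t (.appL u :: C) h, upOracle t (.appL u :: C) h, ?_, ?_, ?_, ?_⟩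
    · funext T
      exact evalsTo_of_step (κ' := some _) rfl
    · funext T
      exact (evalsTo_of_step (κ' := some _) rfl).symm
    · rw [← funext hX]
      refine ihd _ h I hΘ fun n hn T => ?_
      exact (evalsTo_le_or_left _ _).trans (hΦ n (by have := hu n; grind) T)
    · rw [← funext hX', ← hD, ← hU]
      refine ihe _ h I hΘ fun n hn T => ?_
      -- An index declared in both contexts may well occur in `t`, but then `I n` is `⊤`.
      by_cases hn' : Θ n = none
      · exact (evalsTo_le_or_right (toOccurrence_eq_none d hn' (by have := hu n; grind) _ _ _)
          _).trans (hΦ n (by have := hu n; grind) T)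
      · rw [hΘ n hn']
        exact le_top
  | @box Θ Φ t A d ih =>
    have hX : ∀ n, varOracle t (.box :: C) h n = varOracle (.box t) C h n := by
      rintro (_ | n) <;> rfl
    have hD : downOracle (.box t) C h = downOracle t (.box :: C) h := by
      funext T
      exact evalsTo_of_step (κ' := some _) rfl
    refine ⟨upOracle t (.box :: C) h, ?_⟩
    rw [← funext hX, hD]
    exact ih _ h I hΘ fun n hn => absurd rfl hn
  | @letBox Θ Φ Φ₁ Φ₂ t u A B hu d e ihd ihe =>
    have hX : ∀ n, varOracle u (.letArg t :: C) h n = varOracle (.letBox u t) C h n := by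
      rintro (_ | n) <;> rfl
    have hX' : varOracle t (.letBody u :: C) h =
        scons (downOracle u (.letArg t :: C) h) (varOracle (.letBox u t) C h) := by
      funext n
      cases n <;> rfl
    have hD : downOracle (.letBox u t) C h = downOracle t (.letBody u :: C) h := by
      funext T
      exact evalsTo_of_step (κ' := some _) rfl
    have hU : upOracle (.letBox u t) C h = upOracle t (.letBody u :: C) h := by
      funext T
      exact (evalsTo_of_step (κ' := some _) rfl).symm
    refine ⟨downOracle u (.letArg t :: C) h, upOracle u (.letArg t :: C) h, ?_, ?_⟩
    · rw [← funext hX]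
      refine ihd _ h I hΘ fun n hn T => ?_
      exact (evalsTo_le_or_left _ _).trans (hΦ n (by have := hu n; grind) T)
    · rw [← hX', hD, hU]
      refine ihe _ h (scons ⊤ I) ?_ ?_
      · rintro (_ | n) hn
        · rfl
        · exact hΘ n hn
      · rintro (_ | n) hn T
        · exact absurd rfl hn
        by_cases hn' : Θ n = none
        · change Φ₂ n ≠ none at hn
          exact (evalsTo_le_or_right (toOccurrence_eq_none d hn' (by have := hu n; grind) _ _ _)
            _).trans (hΦ n (by have := hu n; grind) T)
        · rw [scons, hΘ n hn']
          exact le_top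

end Config

/-- Soundness of the machine with respect to denotations. -/
theorem Term.IsAlmostPurelyAffine.exists_isOutput {v : Term S} (hv : v.IsAlmostPurelyAffine)
    {Γ : ℕ → Ty} (ρ : Env S Γ) :
    ∃ f, HasDen 0 Γ v .o f ∧ (APAIAM v).IsOutput (f ρ) := by
  obtain ⟨d, hd⟩ := hv
  obtain ⟨f, hf, hr⟩ := hd.exists_realizes (k := 0) (Γ := Γ)
    (by intro n A hn; simp [TyCtx.empty] at hn)
  refine ⟨f, hf, TreeMachine.EvalsTo.isOutput ?_⟩
  have hs := Config.solves_machine (v := v) d [] rfl (fun _ => ⊤) (fun _ _ => rfl)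
    (fun n hn => absurd rfl hn)
  -- At type `o` the root oracle is read at the empty tape, that is, at the initial configuration.
  exact Config.evalsTo_some.1 (hr ρ (fun _ _ _ => True) (by intro n hn; simp [TyCtx.empty] at hn)
    _ _ ⟨_, _, hs, by intro n hn; simp [TyCtx.empty] at hn⟩)

/-! ### Subject reduction, with invariance of the denotation -/

namespace HasDen

theorem var_succ {k : ℕ} {Γ : ℕ → Ty} {n : ℕ} {A : Ty} {g : Env S Γ → A.Den S}
    (h : HasDen k Γ (.var n) A g) (B : Ty) :
    HasDen (k + 1) (scons B Γ) (.var (n + 1)) A fun ρ => g ρ.tail := by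
  generalize ht : Term.var n = t at h
  cases h <;> cases ht
  exact var (Γ := scons B Γ) _ (Nat.succ_lt_succ ‹_›)

/-- Asking for a derivation of `r n`, and not for an equation between `Δ (r n)` and `Γ n`, avoids
casts between denotations. -/
protected theorem rename {k : ℕ} {Γ : ℕ → Ty} {t : Term S} {A : Ty} {f : Env S Γ → A.Den S}
    (h : HasDen k Γ t A f) {m : ℕ} {Δ : ℕ → Ty} {r : ℕ → ℕ} (G : Env S Δ → Env S Γ)
    (hr : ∀ n < k, HasDen m Δ (.var (r n)) (Γ n) fun ρ => G ρ n) :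
    HasDen m Δ (t.rename r) A fun ρ => f (G ρ) := by
  have up : ∀ {k m : ℕ} {Γ Δ : ℕ → Ty} {r : ℕ → ℕ} (G : Env S Δ → Env S Γ) (B : Ty),
      (∀ n < k, HasDen m Δ (.var (r n)) (Γ n) fun ρ => G ρ n) → ∀ n < k + 1,
        HasDen (m + 1) (scons B Δ) (.var (Term.upRen r n)) (scons B Γ n)
          fun ρ => (G ρ.tail).cons (ρ 0) n := by
    rintro k m Γ Δ r G B hr (_ | n) hn
    · exact var (Γ := scons B Δ) 0 m.succ_pos
    · exact (hr n (Nat.lt_of_succ_lt_succ hn)).var_succ B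
  induction h generalizing m Δ r with
  | const c => exact const c
  | var n hn => exact hr n hn
  | @lam k Γ t A B f h ih =>
    -- At `ρ.cons a` this is `f ((G ρ).cons a)` by definition.
    exact lam (f := fun ρ => f ((G ρ.tail).cons (ρ 0))) (ih _ (up G A hr))
  | app _ _ ih ih' => exact app (ih G hr) (ih' G hr)
  | box _ ih => exact box (ih G hr)
  | @letBox k Γ t u A B f g h h' ih ih' =>
    exact letBox (f := fun ρ => f ((G ρ.tail).cons (ρ 0))) (ih G hr) (ih' _ (up G A hr))

protected theorem shift {k : ℕ} {Γ : ℕ → Ty} {t : Term S} {A : Ty} {f : Env S Γ → A.Den S}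
    (h : HasDen k Γ t A f) (B : Ty) :
    HasDen (k + 1) (scons B Γ) (t.shift 1) A fun ρ => f ρ.tail :=
  h.rename Env.tail fun n hn => (var n hn).var_succ B

protected theorem subst {k : ℕ} {Γ : ℕ → Ty} {t : Term S} {A : Ty} {f : Env S Γ → A.Den S}
    (h : HasDen k Γ t A f) {m : ℕ} {Δ : ℕ → Ty} {σ : ℕ → Term S} (G : Env S Δ → Env S Γ)
    (hσ : ∀ n < k, HasDen m Δ (σ n) (Γ n) fun ρ => G ρ n) :
    HasDen m Δ (t.subst σ) A fun ρ => f (G ρ) := by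
  have up : ∀ {k m : ℕ} {Γ Δ : ℕ → Ty} {σ : ℕ → Term S} (G : Env S Δ → Env S Γ) (B : Ty),
      (∀ n < k, HasDen m Δ (σ n) (Γ n) fun ρ => G ρ n) → ∀ n < k + 1,
        HasDen (m + 1) (scons B Δ) (Term.upSubst σ n) (scons B Γ n)
          fun ρ => (G ρ.tail).cons (ρ 0) n := by
    rintro k m Γ Δ σ G B hσ (_ | n) hn
    · exact var (Γ := scons B Δ) 0 m.succ_pos
    · exact (hσ n (Nat.lt_of_succ_lt_succ hn)).shift B
  induction h generalizing m Δ σ with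
  | const c => exact const c
  | var n hn => exact hσ n hn
  | @lam k Γ t A B f h ih =>
    exact lam (f := fun ρ => f ((G ρ.tail).cons (ρ 0))) (ih _ (up G A hσ))
  | app _ _ ih ih' => exact app (ih G hσ) (ih' G hσ)
  | box _ ih => exact box (ih G hσ)
  | @letBox k Γ t u A B f g h h' ih ih' =>
    exact letBox (f := fun ρ => f ((G ρ.tail).cons (ρ 0))) (ih G hσ) (ih' _ (up G A hσ))

/-- The argument `u` crosses the binders of `L` one by one. Its denotation ignores each new
variable. -/
theorem beta_lam {L : List (Term S)} {k : ℕ} {Γ : ℕ → Ty} {t u : Term S} {A B : Ty}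
    {f : Env S Γ → (Ty.arrow A B).Den S} {g : Env S Γ → A.Den S}
    (h : HasDen k Γ (Term.wrapLets L (.lam t)) (.arrow A B) f) (hu : HasDen k Γ u A g) :
    HasDen k Γ (Term.wrapLets L (t.subst (Term.single (u.shift L.length) 0))) B
      fun ρ => f ρ (g ρ) := by
  induction L generalizing k Γ u with
  | nil =>
    cases h with
    | lam h =>
      rw [List.length_nil, Term.shift_zero]
      refine h.subst (fun ρ => ρ.cons (g ρ)) ?_
      rintro (_ | n) hn
      · exact hu
      · exact var n (Nat.lt_of_succ_lt_succ hn)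
  | cons s L ih =>
    cases h with
    | letBox hs h =>
      have := letBox hs (ih h (hu.shift _))
      rw [Term.shift_shift] at this
      exact this

/-- Here it is the body `t` that crosses the binders of `L`: its variable `0` stays in place and the
others are shifted, whence `upRen`. -/
theorem beta_letBox {L : List (Term S)} {k : ℕ} {Γ : ℕ → Ty} {t u : Term S} {A B : Ty}
    {g : Env S Γ → A.Den S} {f : Env S (scons A Γ) → B.Den S}
    (hu : HasDen k Γ (Term.wrapLets L (.box u)) (.bang A) g)
    (h : HasDen (k + 1) (scons A Γ) t B f) :
    HasDen k Γ (Term.wrapLets L (t.subst (Term.single u L.length))) B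
      fun ρ => f (ρ.cons (g ρ)) := by
  induction L generalizing k Γ t with
  | nil =>
    cases hu with
    | box hu =>
      refine h.subst (fun ρ => ρ.cons (g ρ)) ?_
      rintro (_ | n) hn
      · exact hu
      · exact var n (Nat.lt_of_succ_lt_succ hn)
  | cons s L ih =>
    cases hu with
    | @letBox _ _ _ _ C _ _ _ hs hu =>
      have ht := h.rename (m := k + 1 + 1) (Δ := scons A (scons C Γ)) (r := Term.upRen (· + 1))
        (fun ρ => ρ.tail.tail.cons (ρ 0)) (by
          rintro (_ | n) hn
          · exact var (Γ := scons A (scons C Γ)) 0 (Nat.succ_pos _)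
          · exact var (Γ := scons A (scons C Γ)) (n + 2) (Nat.succ_lt_succ hn))
      have := letBox hs (ih hu ht)
      rw [Term.subst_single_rename] at this
      exact this

/-- Subject reduction; reduction preserves denotations. -/
theorem beta {k : ℕ} {Γ : ℕ → Ty} {t t' : Term S} {A : Ty} {f : Env S Γ → A.Den S}
    (h : HasDen k Γ t A f) (r : t.Beta t') : HasDen k Γ t' A f := by
  induction r generalizing k Γ A with
  | lam L t u => cases h with | app h hu => exact h.beta_lam hu
  | letBox L u t => cases h with | letBox hu h => exact hu.beta_letBox h
  | underLam r ih => cases h with | lam h => exact lam (ih h)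
  | appLeft u r ih => cases h with | app h h' => exact app (ih h) h'
  | appRight t r ih => cases h with | app h h' => exact app h (ih h')
  | underBox r ih => cases h with | box h => exact box (ih h)
  | letArg t r ih => cases h with | letBox h h' => exact letBox (ih h) h'
  | letBody u r ih => cases h with | letBox h h' => exact letBox h (ih h')

theorem reflTransGen_beta {k : ℕ} {Γ : ℕ → Ty} {t t' : Term S} {A : Ty} {f : Env S Γ → A.Den S}
    (h : HasDen k Γ t A f) (r : Relation.ReflTransGen Term.Beta t t') : HasDen k Γ t' A f := by
  induction r with
  | refl => exact h
  | tail _ r ih => exact ih.beta r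

end HasDen

/-! ### Reducibility -/

/-- Logical relation between terms and semantic values. -/
def Reducible : (A : Ty) → Term S → A.Den S → Prop
  | .o, t, a => Relation.ReflTransGen Term.Beta t (Term.encode a)
  | .arrow A B, t, f => ∀ (u : Term S) (a : A.Den S), Reducible A u a →
      Reducible B (.app t u) (f a)
  | .bang A, t, a => ∃ r, Relation.ReflTransGen Term.Beta t (.box r) ∧ Reducible A r a

theorem Reducible.expand {A : Ty} {t t' : Term S} {a : A.Den S} (h : Reducible A t' a)
    (r : Relation.ReflTransGen Term.Beta t t') : Reducible A t a := by
  induction A generalizing t t' with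
  | o => exact r.trans h
  | arrow A B ihA ihB =>
    exact fun u b hb => ihB (h u b hb) (r.lift (Term.app · u) fun _ _ => .appLeft u)
  | bang A ih =>
    obtain ⟨s, hs, h⟩ := h
    exact ⟨s, r.trans hs, h⟩

theorem reducible_curriedDen (n : ℕ) (t : Term S) (F : (Fin n → GroundTree S) → GroundTree S)
    (h : ∀ us ts, (∀ i, Relation.ReflTransGen Term.Beta (us i) (Term.encode (ts i))) →
      Relation.ReflTransGen Term.Beta ((List.ofFn us).foldl Term.app t) (Term.encode (F ts))) :
    Reducible (Ty.firstOrder n) t (curriedDen n F) := by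
  induction n generalizing t with
  | zero => exact h Fin.elim0 Fin.elim0 fun i => i.elim0
  | succ n ih =>
    intro u (a : GroundTree S) ha
    refine ih _ _ fun us ts hus => ?_
    have := h (Fin.cons u us) (Fin.cons a ts) fun i => by
      cases i using Fin.cases with
      | zero => exact ha
      | succ i => exact hus i
    simpa using this

namespace Term

theorem reflTransGen_foldl_app {n : ℕ} {us us' : Fin n → Term S} {t t' : Term S}
    (ht : Relation.ReflTransGen Beta t t') (h : ∀ i, Relation.ReflTransGen Beta (us i) (us' i)) :
    Relation.ReflTransGen Beta ((List.ofFn us).foldl app t) ((List.ofFn us').foldl app t') := by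
  induction n generalizing t t' with
  | zero => simpa using ht
  | succ n ih =>
    simp only [List.ofFn_succ, List.foldl_cons]
    refine ih ?_ fun i => h i.succ
    exact (ht.lift (app · (us 0)) fun _ _ => .appLeft _).trans
      ((h 0).lift (app t') fun _ _ => .appRight _)

end Term

/-- Fundamental lemma of the logical relation. The relation is closed under expansion, so exhibiting
one contraction per binder suffices, always with `L` empty. -/
theorem HasDen.reducible {k : ℕ} {Γ : ℕ → Ty} {t : Term S} {A : Ty} {f : Env S Γ → A.Den S}
    (h : HasDen k Γ t A f) {σ : ℕ → Term S} {ρ : Env S Γ}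
    (hσ : ∀ n < k, Reducible (Γ n) (σ n) (ρ n)) : Reducible A (t.subst σ) (f ρ) := by
  have ext : ∀ {k : ℕ} {Γ : ℕ → Ty} {σ : ℕ → Term S} {ρ : Env S Γ} {B : Ty} {u : Term S}
      {b : B.Den S}, (∀ n < k, Reducible (Γ n) (σ n) (ρ n)) → Reducible B u b →
        ∀ n < k + 1, Reducible (scons B Γ n) (scons u σ n) (ρ.cons b n) := by
    rintro k Γ σ ρ B u b hσ hu (_ | n) hn
    · exact hu
    · exact hσ n (Nat.lt_of_succ_lt_succ hn)
  induction h generalizing σ with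
  | const c =>
    refine reducible_curriedDen _ _ _ fun us ts hus => ?_
    rw [Term.encode]
    exact Term.reflTransGen_foldl_app .refl hus
  | var n hn => exact hσ n hn
  | @lam k Γ t A B f h ih =>
    intro u a hu
    refine (ih (ext hσ hu)).expand (.single ?_)
    have := Term.Beta.lam [] (t.subst (Term.upSubst σ)) u
    simp only [List.length_nil, Term.shift_zero, Term.wrapLets] at this
    rw [← Term.subst_single_upSubst]
    exact this
  | app h h' ih ih' => exact ih hσ _ _ (ih' hσ)
  | box h ih => exact ⟨_, .refl, ih hσ⟩
  | @letBox k Γ t u A B f g h h' ih ih' =>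
    obtain ⟨r, hr, hra⟩ := ih hσ
    refine (ih' (ext hσ hra)).expand ?_
    rw [← Term.subst_single_upSubst]
    exact Relation.ReflTransGen.tail
      (hr.lift (Term.letBox · (t.subst (Term.upSubst σ))) fun _ _ => .letArg _) (.letBox [] _ _)

/-- Closed terms of type `o` reduce to the encoding of their denotation. -/
theorem HasDen.reflTransGen_encode {Γ : ℕ → Ty} {t : Term S} {f : Env S Γ → Ty.o.Den S}
    (h : HasDen 0 Γ t .o f) (ρ : Env S Γ) :
    Relation.ReflTransGen Term.Beta t (Term.encode (f ρ)) := by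
  have := h.reducible (σ := .var) (ρ := ρ) fun n hn => absurd hn n.not_lt_zero
  rwa [Term.subst_var] at this

/-! ### Encodings of trees -/

namespace Term

/-- The head of a term and its arguments. -/
def spine : Term S → Term S × List (Term S)
  | app t u => ((spine t).1, (spine t).2 ++ [u])
  | t => (t, [])

theorem spine_foldl_app (l : List (Term S)) (t : Term S) :
    spine (l.foldl app t) = ((spine t).1, (spine t).2 ++ l) := by
  induction l generalizing t with
  | nil => simp
  | cons u l ih => simp [ih, spine]

theorem encode_injective : Function.Injective (encode : GroundTree S → Term S) := by
  intro τ
  induction τ with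
  | leaf x => exact x.elim
  | node c ts ih =>
    rintro (x | ⟨c', ts'⟩) h
    · exact x.elim
    have h' := congrArg spine h
    simp only [encode, spine_foldl_app, spine, Prod.mk.injEq, const.injEq, List.nil_append] at h'
    obtain ⟨rfl, h'⟩ := h'
    have e := List.ofFn_injective h'
    congr 1
    funext i
    exact ih i (congrFun e i)

/-- The head of the spine is a constant, hence never an abstraction under `let`s, and no prefix of
the spine is a redex. -/
theorem exists_beta_of_beta_foldl_app {c : S.Letter} {l : List (Term S)} {t' : Term S}
    (h : Beta (l.foldl app (const c)) t') : ∃ u ∈ l, ∃ u', Beta u u' := by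
  induction l using List.reverseRecOn generalizing t' with
  | nil => cases h
  | append_singleton l u ih =>
    rw [List.foldl_append, List.foldl_cons, List.foldl_nil] at h
    generalize hs : l.foldl app (const c) = s at h
    cases h with
    | lam L t _ =>
      exfalso
      have hs' := congrArg spine hs
      rw [spine_foldl_app] at hs'
      cases L <;> simp [wrapLets, spine] at hs'
    | appLeft _ h =>
      rw [← hs] at h
      obtain ⟨v, hv, h⟩ := ih h
      exact ⟨v, by simp [hv], h⟩
    | appRight _ h => exact ⟨u, by simp, _, h⟩

theorem not_beta_encode (τ : GroundTree S) (t : Term S) : ¬ Beta (encode τ) t := by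
  induction τ generalizing t with
  | leaf x => exact x.elim
  | node c ts ih =>
    intro h
    rw [encode] at h
    obtain ⟨u, hu, u', h⟩ := exists_beta_of_beta_foldl_app h
    obtain ⟨i, rfl⟩ := (List.mem_ofFn' _ _).1 hu
    exact ih i _ h

end Term

/-- Any reduct has the same denotation, so it reduces to the same encoding; if it is normal, it is
that encoding. -/
theorem HasDen.isTheNormalForm {Γ : ℕ → Ty} {t : Term S} {f : Env S Γ → Ty.o.Den S}
    (h : HasDen 0 Γ t .o f) (ρ : Env S Γ) :
    IsTheNormalForm Term.Beta t (Term.encode (f ρ)) := by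
  refine ⟨⟨h.reflTransGen_encode ρ, Term.not_beta_encode _⟩, fun b hb hn => ?_⟩
  rcases ((h.reflTransGen_beta hb).reflTransGen_encode ρ).cases_head with e | ⟨c, hc, _⟩
  · exact e
  · exact (hn c hc).elim

end AffineIAM

theorem proposition4p7 (S : AffineIAM.RankedAlphabet) (v : AffineIAM.Term S)
    (hv : v.IsAlmostPurelyAffine) :
    ∃ τ : AffineIAM.GroundTree S,
      (AffineIAM.APAIAM v).IsOutput τ ∧
      AffineIAM.IsTheNormalForm AffineIAM.Term.Beta v (AffineIAM.Term.encode τ) ∧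
      ∀ σ : AffineIAM.GroundTree S,
        AffineIAM.IsTheNormalForm AffineIAM.Term.Beta v (AffineIAM.Term.encode σ) → σ = τ := by
  -- Some valuation is needed, although `v` is closed. There may be no tree over `S` at all, so the
  -- dummy variables get the type `o ⊸ o`, inhabited by the identity.
  let ρ : AffineIAM.Env S fun _ => .arrow .o .o := fun _ a => a
  obtain ⟨f, hf, ho⟩ := hv.exists_isOutput ρ
  have hn := hf.isTheNormalForm ρ
  exact ⟨f ρ, ho, hn, fun σ hσ => AffineIAM.Term.encode_injective (hn.2 _ hσ.1.1 hσ.1.2)⟩
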